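/- Notation: $2^\omega$ is the Cantor space. For a countable ordinal $\eta\ge 1$, $\mathbf{\Sigma}^0_\eta$ and $\mathbf{\Pi}^0_\eta$ denote the additive and multiplicative Borel classes ($\mathbf{\Sigma}^0_1$ = open, $\mathbf{\Pi}^0_\eta$ = complements of $\mathbf{\Sigma}^0_\eta$ sets, and, for $\eta>1$, $\mathbf{\Sigma}^0_\eta$ = countable unions of sets from $\bigcup_{1\le\zeta<\eta}\mathbf{\Pi}^0_\zeta$). If $X,Y$ are Polish spaces, a Borel set $C\subseteq X\times Y$ is potentially $\mathbf{\Pi}^0_\eta$, written $C\in\mathrm{pot}(\mathbf{\Pi}^0_\eta)$, if there are finer Polish topologies $\sigma$ on $X$ and $\tau$ on $Y$ such that $C$ is a $\mathbf{\Pi}^0_\eta$ subset of $[X,\sigma]\times[Y,\tau]$. Theorem 1.13 (Debs). Let $\xi<\omega_1$. There is no Borel set $S\subseteq 2^\omega\times 2^\omega$ such that, for any Polish spaces $X,Y$ and any disjoint analytic subsets $A,B$ of $X\times Y$, exactly one of the following holds: (a) $A$ is separable from $B$ by a $\mathrm{pot}(\mathbf{\Pi}^0_{1+\xi})$ set, i.e.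 there is $C\in\mathrm{pot}(\mathbf{\Pi}^0_{1+\xi})$ with $A\subseteq C$ and $C\cap B=\emptyset$; (b) there are continuous maps $u:2^\omega\to X$ and $v:2^\omega\to Y$ with $S\subseteq (u\times v)^{-1}(A)$ and $(2^\omega\times 2^\omega)\setminus S\subseteq (u\times v)^{-1}(B)$. (So, in the known dichotomy in which the second inclusion of (b) is only required for $\overline{S}\setminus S$, one cannot replace $\overline{S}\setminus S$ by the full complement of $S$.) -/

import Mathlib

/-- The additive Baire classes of a topological space: `SigmaZero ξ A` says that `A` is `Σ⁰_ξ`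
(boldface). A set is `Σ⁰_1` iff it is open, and, for `ξ > 1`, it is `Σ⁰_ξ` iff it is a
union `⋃ n, A n` where each `A n` is `Π⁰_{η n}` (i.e. its complement is `Σ⁰_{η n}`) for some
`1 ≤ η n < ξ`. No set is `Σ⁰_0`. -/
inductive SigmaZero {X : Type*} [TopologicalSpace X] : Ordinal.{0} → Set X → Prop
  | isOpen {U : Set X} (hU : IsOpen U) : SigmaZero 1 U
  | iUnion {ξ : Ordinal.{0}} (hξ : 1 < ξ) (A : ℕ → Set X) (η : ℕ → Ordinal.{0})
      (hone : ∀ n, 1 ≤ η n) (hlt : ∀ n, η n < ξ) (hA : ∀ n, SigmaZero (η n) (A n)ᶜ) :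
      SigmaZero ξ (⋃ n, A n)

/-- The multiplicative Baire classes: `A` is `Π⁰_ξ` iff its complement is `Σ⁰_ξ`. -/
def PiZero {X : Type*} [TopologicalSpace X] (ξ : Ordinal.{0}) (A : Set X) : Prop :=
  SigmaZero ξ Aᶜ

/-- `A` is potentially `Π⁰_ξ`: it is a Borel subset of `X × Y`, and there are finer Polish
topologies `σ` on `X` and `τ` on `Y` such that `A` is `Π⁰_ξ` in `[X, σ] × [Y, τ]`.
(In Mathlib's order on topologies, `σ ≤ tX` means that `σ` is finer than `tX`.) -/
def PotPiZero {X Y : Type*} [tX : TopologicalSpace X] [tY : TopologicalSpace Y]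
    (ξ : Ordinal.{0}) (A : Set (X × Y)) : Prop :=
  @MeasurableSet (X × Y) (borel (X × Y)) A ∧
    ∃ (σ : TopologicalSpace X) (τ : TopologicalSpace Y),
      σ ≤ tX ∧ τ ≤ tY ∧ @PolishSpace X σ ∧ @PolishSpace Y τ ∧
        @PiZero (X × Y) (@instTopologicalSpaceProd X Y σ τ) ξ A

/-- `A` is separable from `B` by a potentially `Π⁰_ξ` set. -/
def SeparableByPotPiZero {X Y : Type*} [TopologicalSpace X] [TopologicalSpace Y]
    (ξ : Ordinal.{0}) (A B : Set (X × Y)) : Prop :=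
  ∃ C : Set (X × Y), PotPiZero ξ C ∧ A ⊆ C ∧ Disjoint C B

/-- There are continuous maps `u : 2^ω → X` and `v : 2^ω → Y` such that
`S ⊆ (u × v)⁻¹(A)` and `¬S ⊆ (u × v)⁻¹(B)`, where `¬S` is the complement of `S` in the whole
product `2^ω × 2^ω`. -/
def ReducesOnProduct {X Y : Type*} [TopologicalSpace X] [TopologicalSpace Y]
    (S : Set ((ℕ → Bool) × (ℕ → Bool))) (A B : Set (X × Y)) : Prop :=
  ∃ (u : (ℕ → Bool) → X) (v : (ℕ → Bool) → Y), Continuous u ∧ Continuous v ∧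
    S ⊆ Prod.map u v ⁻¹' A ∧ Sᶜ ⊆ Prod.map u v ⁻¹' B

open Set Filter Topology MeasureTheory TopologicalSpace

/-! ### Borel classes -/

/-! Suppose `S` exists. If `S` were potentially `Π⁰_{1+ξ}`, the pair `S`, `Sᶜ` would satisfy both
alternatives: `S` separates, and the identity maps reduce. So it suffices to show that `S` is a
strip over a Borel set, since a finer Polish topology makes that set clopen.

Fix a Borel `D` that is not `Π⁰_{1+ξ}`. In the group of integer functions on finite lists over `ℕ ×
Bool`, let `A` (resp. `B`) consist of the pairs whose difference is the indicator of a branch with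
second coordinates in `D` (resp. `Dᶜ`). Two facts are played against each other.

No potentially `Π⁰_{1+ξ}` set separates `A` from `B`: a finer topology agrees with the old one on a
comeager set, and the free first coordinates of branches let a continuous copy of `2^ω` pass through
it, along which a separating set would trace `D` (`not_separable_branchDifferenceSet`).

Yet `A ∪ B` contains no rectangle with two points on each side, because a sum of two branch
indicators determines the branches (`eq_or_eq_of_rectangle_subset`). The reduction sends the full
product into `A ∪ B`, so `u` or `v` is constant and `S` is a strip. -/

instance polishSpace_cantor : PolishSpace (ℕ → Bool) :=
  have : IsCompletelyMetrizableSpace (ℕ → Bool) :=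
    IsCompletelyMetrizableSpace.pi_countable
  inferInstance

theorem SigmaZero.preimage {X Y : Type*} [TopologicalSpace X] [TopologicalSpace Y] {f : X → Y}
    (hf : Continuous f) {ξ : Ordinal.{0}} {A : Set Y} (hA : SigmaZero ξ A) :
    SigmaZero ξ (f ⁻¹' A) := by
  induction hA with
  | isOpen hU => exact .isOpen (hU.preimage hf)
  | iUnion hξ A η hone hlt _ ih =>
    rw [preimage_iUnion]
    exact .iUnion hξ _ η hone hlt ih

theorem PiZero.preimage {X Y : Type*} [TopologicalSpace X] [TopologicalSpace Y] {f : X → Y}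
    (hf : Continuous f) {ξ : Ordinal.{0}} {A : Set Y} (hA : PiZero ξ A) :
    PiZero ξ (f ⁻¹' A) :=
  SigmaZero.preimage hf hA

theorem IsClopen.piZero {X : Type*} [TopologicalSpace X] {A : Set X} (hA : IsClopen A)
    {ξ : Ordinal.{0}} (hξ : 1 ≤ ξ) : PiZero ξ A := by
  rcases hξ.eq_or_lt with rfl | hξ
  · exact .isOpen hA.compl.isOpen
  · have := SigmaZero.iUnion hξ (fun _ : ℕ => Aᶜ) (fun _ => 1) (fun _ => le_rfl) (fun _ => hξ)
      (fun _ => .isOpen (by rw [compl_compl]; exact hA.isOpen))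
    rwa [iUnion_const] at this

theorem Ordinal.countable_Iio_of_lt_omega_one {ξ : Ordinal.{0}} (hξ : ξ < Ordinal.omega 1) :
    Countable (Iio ξ) := by
  rw [Cardinal.lt_omega_iff_card_lt, ← Cardinal.succ_aleph0, Order.lt_succ_iff] at hξ
  rw [← Cardinal.mk_le_aleph0_iff, Cardinal.mk_Iio_ordinal]
  rw [Cardinal.lift_le_aleph0]
  exact hξ

/-- For a countable ordinal `ξ`, the `Σ⁰_ξ` subsets of the Cantor space are the sections of a
single Borel set. -/
theorem exists_measurableSet_universal_sigmaZero {ξ : Ordinal.{0}} (hξ : ξ < Ordinal.omega 1) :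
    ∃ U : Set ((ℕ → Bool) × (ℕ → Bool)), MeasurableSet U ∧
      ∀ A : Set (ℕ → Bool), SigmaZero ξ A → ∃ p, ∀ x, x ∈ A ↔ (p, x) ∈ U := by
  induction ξ using WellFoundedLT.induction with
  | ind ξ ih =>
  by_cases h1 : ξ = 1
  · obtain ⟨b, hbc, -, hb⟩ := exists_countable_basis (ℕ → Bool)
    obtain ⟨f, hf⟩ := (hbc.union (countable_singleton ∅)).exists_eq_range
      ⟨∅, Or.inr rfl⟩
    have hfo : ∀ n, IsOpen (f n) := fun n => by
      have : f n ∈ b ∪ {∅} := hf ▸ mem_range_self n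
      rcases this with h | h
      · exact hb.isOpen h
      · rw [mem_singleton_iff.1 h]; exact isOpen_empty
    refine ⟨⋃ n, {q | q.1 n = true ∧ q.2 ∈ f n}, ?_, ?_⟩
    · refine .iUnion fun n => .inter ?_ ?_
      · exact (measurableSet_singleton true).preimage ((measurable_pi_apply n).comp measurable_fst)
      · exact (hfo n).measurableSet.preimage measurable_snd
    · intro A hA
      classical
      refine ⟨fun n => decide (f n ⊆ A), fun x => ?_⟩
      have hAo : IsOpen A := by
        cases hA with
        | isOpen h => exact h
        | iUnion h => exact absurd h1 h.ne'
      simp only [mem_iUnion, mem_ofPred_eq, decide_eq_true_eq]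
      constructor
      · intro hx
        obtain ⟨v, hv, hxv, hvA⟩ := hb.exists_subset_of_mem_open hx hAo
        obtain ⟨n, rfl⟩ : v ∈ range f := hf ▸ Or.inl hv
        exact ⟨n, hvA, hxv⟩
      · rintro ⟨n, h, hx⟩
        exact h hx
  · have := Ordinal.countable_Iio_of_lt_omega_one hξ
    obtain ⟨enc, henc⟩ := Countable.exists_injective_nat (Iio ξ)
    choose U hUm hU using fun η : Iio ξ => ih η.1 η.2 (η.2.trans hξ)
    -- For each `n` and `η`, slot `0` of the parameter flags whether the `n`-th piece has class `η`;
    -- slots `m + 1` hold a code for its complement.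
    refine ⟨⋃ (n : ℕ) (η : Iio ξ),
      {q | q.1 (Nat.pair (Nat.pair n (enc η)) 0) = true ∧
        ((fun m => q.1 (Nat.pair (Nat.pair n (enc η)) (m + 1))), q.2) ∉ U η}, ?_, ?_⟩
    · refine .iUnion fun n => .iUnion fun η => .inter ?_ ?_
      · exact (measurableSet_singleton true).preimage ((measurable_pi_apply _).comp measurable_fst)
      · refine MeasurableSet.preimage (hUm η).compl (Measurable.prodMk ?_ measurable_snd)
        exact measurable_pi_lambda _ fun m => (measurable_pi_apply _).comp measurable_fst
    · intro A hA
      cases hA with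
      | isOpen h => exact absurd rfl h1
      | iUnion h A η hone hlt hA =>
        choose q hq using fun n => hU ⟨η n, hlt n⟩ _ (hA n)
        refine ⟨fun j => Nat.casesOn j.unpair.2
          (decide (j.unpair.1.unpair.2 = enc ⟨η j.unpair.1.unpair.1, hlt _⟩))
          (fun m => q j.unpair.1.unpair.1 m), fun x => ?_⟩
        simp only [mem_iUnion, mem_ofPred_eq, Nat.unpair_pair]
        refine exists_congr fun n => ?_
        constructor
        · exact fun hx => ⟨⟨η n, hlt n⟩, decide_eq_true rfl, fun h => (hq n x).2 h hx⟩
        · rintro ⟨η', h, hx⟩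
          by_contra hxA
          rw [henc (of_decide_eq_true h)] at hx
          exact hx ((hq n x).1 hxA)

/-- Cantor's diagonal argument on the universal set. -/
theorem exists_measurableSet_not_piZero {ξ : Ordinal.{0}} (hξ : ξ < Ordinal.omega 1) :
    ∃ D : Set (ℕ → Bool), MeasurableSet D ∧ ¬ PiZero ξ D := by
  obtain ⟨U, hUm, hU⟩ := exists_measurableSet_universal_sigmaZero hξ
  refine ⟨{x | (x, x) ∈ U}, hUm.preimage (measurable_id.prodMk measurable_id), fun h => ?_⟩
  obtain ⟨p, hp⟩ := hU _ h
  have := hp p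
  simp only [mem_compl_iff, mem_ofPred_eq] at this
  tauto

/-! ### Finer Polish topologies -/

/-- A finer Polish topology coincides with the original one on a comeager set. -/
theorem exists_residual_continuous_of_finer {X : Type*} {σ : TopologicalSpace X}
    [tX : TopologicalSpace X] [PolishSpace X] (hσ : σ ≤ tX) (hp : @PolishSpace X σ) :
    ∃ G ∈ residual X, ∀ {Z : Type} [TopologicalSpace Z] (h : Z → X), Continuous h →
      (∀ z, h z ∈ G) → Continuous[_, σ] h := by
  obtain ⟨b, hbc, -, hb⟩ :=
    @exists_countable_basis X σ (@PolishSpace.toSecondCountableTopology X σ hp)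
  -- Both topologies have the same Borel sets, so a `σ`-open set has the Baire property in the
  -- original one.
  have key : ∀ V ∈ b, ∃ O : Set X, IsOpen O ∧ V =ᵇ O := fun V hV => by
    refine @MeasurableSet.residualEq_isOpen X tX V (@borel X tX)
      (@BorelSpace.mk X tX (@borel X tX) rfl) ?_
    refine (borel_eq_borel_of_le hp ‹_› hσ).le V ?_
    exact MeasurableSpace.measurableSet_generateFrom
      (@IsTopologicalBasis.isOpen X σ _ _ hb hV)
  choose! O hO hVO using key
  refine ⟨⋂ V ∈ b, {x | x ∈ V ↔ x ∈ O V}, ?_, ?_⟩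
  · rw [countable_bInter_mem hbc]
    intro V hV
    filter_upwards [hVO V hV] with x hx
    exact iff_of_eq hx
  · intro Z _ h hc hG
    refine (@IsTopologicalBasis.continuous_iff Z X _ σ b hb h).2 fun V hV => ?_
    have : h ⁻¹' V = h ⁻¹' O V := by
      ext z
      exact mem_iInter₂.1 (hG z) V hV
    rw [this]
    exact (hO V hV).preimage hc

/-! ### Indicators of branches -/

open Classical in
/-- The indicator function of the set of finite initial segments of `s`. -/
noncomputable def branchIndicator {Q : Type*} (s : ℕ → Q) (t : List Q) : ℤ :=
  if ∀ j : Fin t.length, s j = t.get j then 1 else 0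

open Classical in
/-- The indicator function of the set of prefixes of a list. -/
noncomputable def prefixIndicator {Q : Type*} (l t : List Q) : ℤ :=
  if t <+: l then 1 else 0

theorem continuous_branchIndicator {Q : Type*} [TopologicalSpace Q] [DiscreteTopology Q] :
    Continuous (branchIndicator : (ℕ → Q) → List Q → ℤ) := by
  classical
  refine continuous_pi fun t => ?_
  refine Continuous.if (fun a ha => ?_) continuous_const continuous_const
  have : IsClopen {s : ℕ → Q | ∀ j : Fin t.length, s j = t.get j} := by
    simp only [ofPred_forall]
    exact isClopen_iInter_of_finite fun j =>
      (isClopen_discrete {t.get j}).preimage (continuous_apply (j : ℕ))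
  rw [this.frontier_eq] at ha
  exact ha.elim

/-- Sums of two branch indicators determine the branches. -/
theorem eq_or_eq_of_branchIndicator_add {Q : Type*} {a b c d : ℕ → Q}
    (h : branchIndicator a + branchIndicator d = branchIndicator b + branchIndicator c) :
    a = b ∨ a = c := by
  by_contra! hne
  obtain ⟨⟨i, hi⟩, ⟨j, hj⟩⟩ := hne.imp Function.ne_iff.1 Function.ne_iff.1
  -- This initial segment of `a` is long enough to leave both `b` and `c`: the left side is at least
  -- 1 there, the right side is 0.
  have h' := congrFun h (List.ofFn fun k : Fin (max i j + 1) => a k)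
  simp only [Pi.add_apply, branchIndicator] at h'
  rw [if_pos (by simp [-List.ofFn_succ]),
    if_neg (c := ∀ _, b _ = _), if_neg (c := ∀ _, c _ = _)] at h'
  · split_ifs at h' <;> omega
  · intro hc
    exact hj (by simpa [-List.ofFn_succ] using (hc ⟨j, by simp⟩).symm)
  · intro hb
    exact hi (by simpa [-List.ofFn_succ] using (hb ⟨i, by simp⟩).symm)

theorem branchIndicator_injective {Q : Type*} :
    Function.Injective (branchIndicator : (ℕ → Q) → List Q → ℤ) := fun _ b h =>
  (eq_or_eq_of_branchIndicator_add (d := b) (congrArg (· + branchIndicator b) h)).elim id id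

/-! ### Branches through a comeager set -/

/-- The finite approximations of the branch that follows `z` in its second coordinates and whose
first coordinates are chosen by `N`. -/
def steeredList (N : List (ℕ × Bool) → ℕ) (z : ℕ → Bool) : ℕ → List (ℕ × Bool)
  | 0 => []
  | i + 1 => steeredList N z i ++ [(N (steeredList N z i), z i)]

/-- The branch that follows `z` in its second coordinates and whose first coordinates are chosen
by `N`. -/
def steeredBranch (N : List (ℕ × Bool) → ℕ) (z : ℕ → Bool) (i : ℕ) : ℕ × Bool :=
  (N (steeredList N z i), z i)

theorem steeredList_eq_ofFn (N : List (ℕ × Bool) → ℕ) (z : ℕ → Bool) (i : ℕ) :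
    steeredList N z i = List.ofFn fun j : Fin i => steeredBranch N z j := by
  induction i with
  | zero => simp [steeredList]
  | succ i ih =>
    rw [List.ofFn_succ', List.concat_eq_append]
    simp only [steeredList, Fin.val_castSucc, Fin.val_last, ← ih]
    rfl

theorem eventually_steeredList_eq (N : List (ℕ × Bool) → ℕ) (z : ℕ → Bool) (i : ℕ) :
    ∀ᶠ z' in 𝓝 z, steeredList N z' i = steeredList N z i := by
  induction i with
  | zero => simp [steeredList]
  | succ i ih =>
    have : ∀ᶠ z' in 𝓝 z, z' i = z i :=
      (continuous_apply i).continuousAt.eventually (eventually_of_mem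
        (mem_nhds_discrete.2 (mem_singleton (z i))) fun _ h => h)
    filter_upwards [ih, this] with z' h1 h2
    simp only [steeredList, h1, h2]

theorem continuous_steeredBranch (N : List (ℕ × Bool) → ℕ) : Continuous (steeredBranch N) := by
  refine continuous_pi fun i => Continuous.prodMk ?_ (continuous_apply i)
  refine continuous_iff_continuousAt.2 fun z => tendsto_const_nhds.congr' ?_
  filter_upwards [eventually_steeredList_eq N z i] with z' h
  rw [h]

/-- If the next first coordinate does not occur in the list `t`, the branch and its finite
approximation have the same indicator at `t`. -/
theorem branchIndicator_steeredBranch_eq {N : List (ℕ × Bool) → ℕ} {z : ℕ → Bool} {i : ℕ}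
    {t : List (ℕ × Bool)} (ht : ∀ q ∈ t, q.1 ≠ N (steeredList N z i)) :
    branchIndicator (steeredBranch N z) t = prefixIndicator (steeredList N z i) t := by
  unfold branchIndicator prefixIndicator
  congr 1
  rw [eq_iff_iff]
  rw [steeredList_eq_ofFn] at ht
  rw [steeredList_eq_ofFn]
  constructor
  · intro h
    -- A longer `t` on the branch would contain the excluded coordinate at position `i`.
    have hlen : t.length ≤ i := by
      by_contra! hlt
      refine ht _ (t.get_mem ⟨i, hlt⟩) ?_
      rw [← h ⟨i, hlt⟩, ← steeredList_eq_ofFn]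
      rfl
    rw [List.prefix_iff_eq_take]
    refine List.ext_get (by simp [hlen]) fun n h1 h2 => ?_
    have := h ⟨n, h1⟩
    simp at this ⊢
    exact this.symm
  · rintro h j
    have := h.getElem j.2
    simp at this ⊢
    exact this.symm

/-- For every comeager set `G` there is a translate of the set of branch indicators such that
each `z` is the sequence of second coordinates of a branch, continuous in `z`, whose translated
indicator is in `G`. -/
theorem exists_translate_steered_mem_residual {G : Set (List (ℕ × Bool) → ℤ)}
    (hG : G ∈ residual _) :
    ∃ (y : List (ℕ × Bool) → ℤ) (N : List (ℕ × Bool) → ℕ),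
      ∀ z, y + branchIndicator (steeredBranch N z) ∈ G := by
  obtain ⟨G', hG'G, hδ, hd⟩ := mem_residual.1 hG
  obtain ⟨O, hO, rfl⟩ := isGδ_iff_eq_iInter_nat.1 hδ
  have hres : (⋂ n, O n) ∈ residual _ := mem_residual.2 ⟨_, Subset.rfl, hδ, hd⟩
  -- Translations are homeomorphisms and there are countably many lists, so a generic `y` works for
  -- all of them.
  have hy : ∀ᶠ y in residual (List (ℕ × Bool) → ℤ), ∀ l, y + prefixIndicator l ∈ ⋂ n, O n := by
    rw [eventually_countable_forall]
    intro l
    exact tendsto_residual_of_isOpenMap (Homeomorph.addRight (prefixIndicator l)).continuous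
      (Homeomorph.addRight (prefixIndicator l)).isOpenMap hres
  obtain ⟨y, hy⟩ := (dense_of_mem_residual hy).nonempty
  -- Membership in `O l.length` is secured by finitely many coordinates; stage `i` of the branch
  -- handles `O i`.
  have hF : ∀ l, ∃ F : Finset (List (ℕ × Bool)), ∀ x : List (ℕ × Bool) → ℤ,
      (∀ t ∈ F, x t = y t + prefixIndicator l t) → x ∈ O l.length := fun l => by
    obtain ⟨F, u, hu, hsub⟩ := isOpen_pi_iff.1 (hO l.length) _ (mem_iInter.1 (hy l) l.length)
    exact ⟨F, fun x hx => hsub fun t ht => by rw [hx t ht]; exact (hu t ht).2⟩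
  choose F hF using hF
  -- A fresh first coordinate keeps the rest of the branch from changing the values on `F l`.
  have hN : ∀ l, ∃ n : ℕ, ∀ t ∈ F l, ∀ q ∈ t, q.1 ≠ n := fun l => by
    obtain ⟨n, hn⟩ := Infinite.exists_notMem_finset
      ((F l).biUnion fun t => (t.map Prod.fst).toFinset)
    refine ⟨n, fun t ht q hq hqn => hn ?_⟩
    simp only [Finset.mem_biUnion, List.mem_toFinset, List.mem_map]
    exact ⟨t, ht, q, hq, hqn⟩
  choose N hN using hN
  refine ⟨y, N, fun z => hG'G (mem_iInter.2 fun i => ?_)⟩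
  have hlen : (steeredList N z i).length = i := by rw [steeredList_eq_ofFn]; simp
  have := hF (steeredList N z i) (y + branchIndicator (steeredBranch N z)) fun t ht => by
    simp only [Pi.add_apply, branchIndicator_steeredBranch_eq (hN _ t ht)]
  rwa [hlen] at this

theorem continuous_translate_steered (y : List (ℕ × Bool) → ℤ) (N : List (ℕ × Bool) → ℕ) :
    Continuous fun z => y + branchIndicator (steeredBranch N z) :=
  continuous_const.add (continuous_branchIndicator.comp (continuous_steeredBranch N))

theorem exists_translate_steered_continuous_of_finer
    {σ : TopologicalSpace (List (ℕ × Bool) → ℤ)} (hσ : σ ≤ Pi.topologicalSpace)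
    (hp : @PolishSpace _ σ) :
    ∃ (y : List (ℕ × Bool) → ℤ) (N : List (ℕ × Bool) → ℕ),
      Continuous[_, σ] fun z => y + branchIndicator (steeredBranch N z) := by
  obtain ⟨G, hG, hcont⟩ :=
    @exists_residual_continuous_of_finer _ σ Pi.topologicalSpace inferInstance hσ hp
  obtain ⟨y, N, hy⟩ := exists_translate_steered_mem_residual hG
  exact ⟨y, N, hcont _ (continuous_translate_steered y N) hy⟩

/-! ### The non-separable pair -/

/-- The pairs whose difference is the indicator of a branch with second coordinates in `D`. -/
def branchDifferenceSet (D : Set (ℕ → Bool)) :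
    Set ((List (ℕ × Bool) → ℤ) × (List (ℕ × Bool) → ℤ)) :=
  {w | ∃ s : ℕ → ℕ × Bool, w.1 = w.2 + branchIndicator s ∧ (fun i => (s i).2) ∈ D}

theorem analyticSet_branchDifferenceSet {D : Set (ℕ → Bool)} (hD : MeasurableSet D) :
    AnalyticSet (branchDifferenceSet D) := by
  let E : Set ((ℕ → ℕ × Bool) × (List (ℕ × Bool) → ℤ)) := {q | (fun i => (q.1 i).2) ∈ D}
  have hE : AnalyticSet E := hD.analyticSet.preimage
    (f := fun q : (ℕ → ℕ × Bool) × (List (ℕ × Bool) → ℤ) => fun i => (q.1 i).2) (by fun_prop)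
  have hf : Continuous fun q : (ℕ → ℕ × Bool) × (List (ℕ × Bool) → ℤ) =>
      (q.2 + branchIndicator q.1, q.2) :=
    (continuous_snd.add (continuous_branchIndicator.comp continuous_fst)).prodMk continuous_snd
  convert hE.image_of_continuous hf using 1
  ext ⟨x, y⟩
  constructor
  · rintro ⟨s, h, hs⟩
    exact ⟨(s, y), hs, Prod.ext h.symm rfl⟩
  · rintro ⟨⟨s, y'⟩, hs, h⟩
    obtain ⟨rfl, rfl⟩ := Prod.mk.inj h
    exact ⟨s, rfl, hs⟩

theorem disjoint_branchDifferenceSet {D E : Set (ℕ → Bool)} (h : Disjoint D E) :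
    Disjoint (branchDifferenceSet D) (branchDifferenceSet E) := by
  rw [Set.disjoint_left]
  rintro w ⟨s, hw, hs⟩ ⟨s', hw', hs'⟩
  obtain rfl := branchIndicator_injective (add_left_cancel (hw.symm.trans hw'))
  exact Set.disjoint_left.1 h hs hs'

/-- The map `z ↦ (y + branchIndicator (steeredBranch N z), y)` is continuous into the finer product,
and it pulls `C` back to `D`. The second coordinate is constant, so `τ` plays no role. -/
theorem not_separable_branchDifferenceSet {ξ : Ordinal.{0}} {D : Set (ℕ → Bool)}
    (hD : ¬ PiZero ξ D) :
    ¬ SeparableByPotPiZero ξ (branchDifferenceSet D) (branchDifferenceSet Dᶜ) := by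
  rintro ⟨C, ⟨-, σ, τ, hσ, -, hσp, -, hC⟩, hAC, hCB⟩
  obtain ⟨y, N, h1⟩ := exists_translate_steered_continuous_of_finer hσ hσp
  have h2 := @Continuous.prodMk _ _ _ σ τ _ _ _ h1 (@continuous_const _ _ _ τ y)
  refine hD ?_
  convert @PiZero.preimage _ _ _ (@instTopologicalSpaceProd _ _ σ τ) _ h2 _ _ hC
  ext z
  constructor
  · intro hz
    exact hAC ⟨steeredBranch N z, rfl, hz⟩
  · intro hz
    by_contra hzD
    exact Set.disjoint_left.1 hCB hz ⟨steeredBranch N z, rfl, hzD⟩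

/-- A product contained in the set of all branch differences has a side with at most one point. -/
theorem eq_or_eq_of_rectangle_subset {D E : Set (ℕ → Bool)} {x x' y y' : List (ℕ × Bool) → ℤ}
    (h : ∀ a ∈ ({x, x'} : Set _), ∀ b ∈ ({y, y'} : Set _),
      (a, b) ∈ branchDifferenceSet D ∪ branchDifferenceSet E) : x = x' ∨ y = y' := by
  have h' : ∀ a ∈ ({x, x'} : Set _), ∀ b ∈ ({y, y'} : Set _),
      ∃ s : ℕ → ℕ × Bool, a = b + branchIndicator s := fun a ha b hb => by
    rcases h a ha b hb with ⟨s, hs, -⟩ | ⟨s, hs, -⟩ <;> exact ⟨s, hs⟩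
  obtain ⟨a, ha⟩ := h' x (by simp) y (by simp)
  obtain ⟨b, hb⟩ := h' x (by simp) y' (by simp)
  obtain ⟨c, hc⟩ := h' x' (by simp) y (by simp)
  obtain ⟨d, hd⟩ := h' x' (by simp) y' (by simp)
  have hsum : branchIndicator a + branchIndicator d = branchIndicator b + branchIndicator c := by
    have h1 := ha.symm.trans hb
    have h2 := hc.symm.trans hd
    ext t
    have h1 := congrFun h1 t
    have h2 := congrFun h2 t
    simp only [Pi.add_apply] at h1 h2 ⊢
    omega
  rcases eq_or_eq_of_branchIndicator_add hsum with rfl | rfl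
  · exact .inr (add_right_cancel (ha.symm.trans hb))
  · exact .inl (ha.trans hc.symm)

/-! ### Strips -/

/-- Refining the topology of one factor makes `E`, hence the strip over it, clopen. -/
theorem potPiZero_preimage_fst {X Y : Type*} [TopologicalSpace X] [PolishSpace X]
    [tY : TopologicalSpace Y] [PolishSpace Y] {ξ : Ordinal.{0}} (hξ : 1 ≤ ξ) {E : Set X}
    (hE : MeasurableSet[borel X] E) : PotPiZero ξ (Prod.fst ⁻¹' E : Set (X × Y)) := by
  let _ : MeasurableSpace X := borel X
  have : BorelSpace X := ⟨rfl⟩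
  let _ : MeasurableSpace (X × Y) := borel (X × Y)
  have : BorelSpace (X × Y) := ⟨rfl⟩
  refine ⟨hE.preimage continuous_fst.measurable, ?_⟩
  obtain ⟨σ, hσ, hσp, hc, ho⟩ := MeasurableSet.isClopenable hE
  refine ⟨σ, tY, hσ, le_rfl, hσp, ‹_›, ?_⟩
  exact PiZero.preimage continuous_fst (IsClopen.piZero ⟨hc, ho⟩ hξ)

theorem potPiZero_preimage_snd {X Y : Type*} [tX : TopologicalSpace X] [PolishSpace X]
    [TopologicalSpace Y] [PolishSpace Y] {ξ : Ordinal.{0}} (hξ : 1 ≤ ξ) {E : Set Y}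
    (hE : MeasurableSet[borel Y] E) : PotPiZero ξ (Prod.snd ⁻¹' E : Set (X × Y)) := by
  let _ : MeasurableSpace Y := borel Y
  have : BorelSpace Y := ⟨rfl⟩
  let _ : MeasurableSpace (X × Y) := borel (X × Y)
  have : BorelSpace (X × Y) := ⟨rfl⟩
  refine ⟨hE.preimage continuous_snd.measurable, ?_⟩
  obtain ⟨τ, hτ, hτp, hc, ho⟩ := MeasurableSet.isClopenable hE
  refine ⟨tX, τ, le_rfl, hτ, ‹_›, hτp, ?_⟩
  exact PiZero.preimage continuous_snd (IsClopen.piZero ⟨hc, ho⟩ hξ)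

theorem theorem1p13 (ξ : Ordinal.{0}) (hξ : ξ < Ordinal.omega 1) :
    ¬ ∃ S : Set ((ℕ → Bool) × (ℕ → Bool)),
      @MeasurableSet ((ℕ → Bool) × (ℕ → Bool)) (borel ((ℕ → Bool) × (ℕ → Bool))) S ∧
        ∀ (X Y : Type) [TopologicalSpace X] [PolishSpace X] [TopologicalSpace Y] [PolishSpace Y]
          (A B : Set (X × Y)),
          MeasureTheory.AnalyticSet A → MeasureTheory.AnalyticSet B → Disjoint A B →
            Xor (SeparableByPotPiZero (1 + ξ) A B) (ReducesOnProduct S A B) := by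
  rintro ⟨S, hS, H⟩
  have hle : 1 ≤ 1 + ξ := le_self_add
  have hlt : 1 + ξ < Ordinal.omega 1 :=
    Ordinal.isPrincipal_add_omega 1 (Ordinal.one_lt_omega0.trans Ordinal.omega0_lt_omega_one) hξ
  rw [← BorelSpace.measurable_eq] at hS
  -- Exclusivity of the two alternatives is used here, for the pair `S`, `Sᶜ`.
  have hSpot : ¬ PotPiZero (1 + ξ) S := fun h => by
    rcases H _ _ S Sᶜ hS.analyticSet hS.compl.analyticSet disjoint_compl_right with h' | h'
    · exact h'.2 ⟨id, id, continuous_id, continuous_id, fun _ h => h, fun _ h => h⟩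
    · exact h'.2 ⟨S, h, Subset.rfl, disjoint_compl_right⟩
  obtain ⟨D, hD, hDξ⟩ := exists_measurableSet_not_piZero hlt
  have hdisj := disjoint_branchDifferenceSet (disjoint_compl_right (a := D))
  obtain ⟨u, v, -, -, hSA, hSB⟩ : ReducesOnProduct S (branchDifferenceSet D)
      (branchDifferenceSet Dᶜ) := by
    rcases H _ _ _ _ (analyticSet_branchDifferenceSet hD)
      (analyticSet_branchDifferenceSet hD.compl) hdisj with h | h
    · exact absurd h.1 (not_separable_branchDifferenceSet hDξ)
    · exact h.1
  have hmem : ∀ α β, (α, β) ∈ S ↔ (u α, v β) ∈ branchDifferenceSet D := fun α β =>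
    ⟨fun h => hSA h, fun h => by
      by_contra hn
      exact Set.disjoint_left.1 hdisj h (hSB hn)⟩
  have hrect : ∀ α β, (u α, v β) ∈ branchDifferenceSet D ∪ branchDifferenceSet Dᶜ := fun α β => by
    by_cases h : (α, β) ∈ S
    · exact .inl (hSA h)
    · exact .inr (hSB h)
  have hconst : (∀ α α', u α = u α') ∨ ∀ β β', v β = v β' := by
    by_contra! hne
    obtain ⟨⟨α, α', hα⟩, β, β', hβ⟩ := hne
    refine (eq_or_eq_of_rectangle_subset (D := D) (E := Dᶜ) ?_).elim hα hβ
    rintro a (rfl | rfl) b (rfl | rfl) <;> exact hrect _ _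
  let o : ℕ → Bool := fun _ => false
  rcases hconst with hu | hv
  · have hE : MeasurableSet {β | (o, β) ∈ S} := hS.preimage measurable_prodMk_left
    rw [BorelSpace.measurable_eq (α := ℕ → Bool)] at hE
    refine hSpot ?_
    convert potPiZero_preimage_snd (X := ℕ → Bool) hle hE
    ext ⟨α, β⟩
    change _ ↔ (o, β) ∈ S
    rw [hmem, hmem, hu α o]
  · have hE : MeasurableSet {α | (α, o) ∈ S} := hS.preimage measurable_prodMk_right
    rw [BorelSpace.measurable_eq (α := ℕ → Bool)] at hE
    refine hSpot ?_
    convert potPiZero_preimage_fst (Y := ℕ → Bool) hle hE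
    ext ⟨α, β⟩
    change _ ↔ (α, o) ∈ S
    rw [hmem, hmem, hv β o]
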